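/- Let $n\ge 0$ be an integer. For $n\ge 1$ let $G_n$ be the graph with the $8n+2$ vertices $u_0,v_0$ and $u_i,v_i,w_i,z_i$ $(1\le i\le 2n)$ and with the following edges: $u_iv_i$ for $0\le i\le 2n$; $u_iu_{i+1}$ and $v_iv_{i+1}$ for $0\le i\le 2n-1$; $u_iw_i$ and $v_iz_i$ for $1\le i\le 2n$; and $w_iw_{i+1}$ and $z_iz_{i+1}$ for odd $i$ with $1\le i\le 2n-1$. (So $G_n$ is the polyomino graph formed by $4n$ unit squares of the plane grid: a horizontal row of $2n$ squares, together with the square directly above and the square directly below each of the 2nd, 4th, ..., $2n$-th squares of that row.) Let $G_0$ be the null graph, which has no vertices and exactly one perfect matching, the empty one. For a perfect matching $M$ of a finite graph $G$, a forcing set of $M$ is a set $S\subseteq M$ of edges that is contained in no perfect matching of $G$ other than $M$, and the forcing number $f(G,M)$ is the smallest size of a forcing set of $M$. Let $F(G,x)=\sum_{M}x^{f(G,M)}$, where $M$ runs over all perfect matchings of $G$, and let the degree of freedom of $G$ be $$IDF(G)=\frac{d}{dx}F(G,x)\Big|_{x=1}=\sum_{M} f(G,M).$$ Then, for every integer $n\ge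 0$, $$IDF(G_n)=-4+\frac{50+22\sqrt5}{25}(3-\sqrt5)^n+\frac{13-3\sqrt5}{10}\,n(3-\sqrt5)^n+\frac{50-22\sqrt5}{25}(3+\sqrt5)^n+\frac{13+3\sqrt5}{10}\,n(3+\sqrt5)^n.$$ -/

import Mathlib

/-- `S` is a forcing set of the perfect matching `M` of `G`: `S` is a set of edges of `M`, and no
other perfect matching of `G` contains `S`. -/
def IsForcingSet {V : Type*} {G : SimpleGraph V} (M : G.Subgraph) (S : Set (Sym2 V)) : Prop :=
  S ⊆ M.edgeSet ∧ ∀ M' : G.Subgraph, M'.IsPerfectMatching → S ⊆ M'.edgeSet → M' = M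

/-- The forcing number `f(G, M)`: the smallest size of a (finite) forcing set of `M`. In a finite
graph the edge set of a perfect matching `M` is itself a forcing set of `M`, so the infimum is
attained. -/
noncomputable def forcingNumber {V : Type*} {G : SimpleGraph V} (M : G.Subgraph) : ℕ :=
  sInf {k : ℕ | ∃ S : Finset (Sym2 V), IsForcingSet M (S : Set (Sym2 V)) ∧ S.card = k}

/-- The finite collection of all perfect matchings of a finite graph. -/
noncomputable def perfectMatchings {V : Type*} [Finite V] (G : SimpleGraph V) :
    Finset G.Subgraph :=
  (Set.toFinite {M : G.Subgraph | M.IsPerfectMatching}).toFinset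

/-- The forcing polynomial `F(G, x)`, the sum of `x ^ f(G, M)` over all perfect matchings `M`. -/
noncomputable def forcingPolynomial {V : Type*} [Finite V] (G : SimpleGraph V) : Polynomial ℕ :=
  ∑ M ∈ perfectMatchings G, Polynomial.X ^ forcingNumber M

/-- The degree of freedom `IDF(G)`: the derivative of the forcing polynomial at `x = 1`. -/
noncomputable def degreeOfFreedom {V : Type*} [Finite V] (G : SimpleGraph V) : ℕ :=
  (Polynomial.derivative (forcingPolynomial G)).eval 1

/-- The degree of freedom is the sum of the forcing numbers of all perfect matchings. -/
theorem degreeOfFreedom_eq_sum {V : Type*} [Finite V] (G : SimpleGraph V) :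
    degreeOfFreedom G = ∑ M ∈ perfectMatchings G, forcingNumber M := by
  simp [degreeOfFreedom, forcingPolynomial, Polynomial.eval_finsetSum,
    Polynomial.derivative_X_pow]

/-- The vertices of `G_n`, as points `(column, row)` of the plane grid. The rows `0, 1, 2, 3`
contain the vertices `z_i, v_i, u_i, w_i` respectively, in column `i`; here `0 ≤ i ≤ 2n` for `u_i`
and `v_i`, and `1 ≤ i ≤ 2n` for `w_i` and `z_i`. By convention `G_0` is the null graph, which has
no vertices. -/
def polyominoVertices (n : ℕ) : Set (ℕ × ℕ) :=
  {p | 1 ≤ n ∧ p.1 ≤ 2 * n ∧ p.2 ≤ 3 ∧ (p.1 = 0 → p.2 = 1 ∨ p.2 = 2)}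

instance polyominoVertices_finite (n : ℕ) : Finite (polyominoVertices n) :=
  Set.Finite.to_subtype <| (Set.finite_Iic ((2 * n, 3) : ℕ × ℕ)).subset fun _ hp =>
    Prod.mk_le_mk.2 ⟨hp.2.1, hp.2.2.1⟩

/-- The polyomino graph `G_n`. Its edges are the vertical unit segments between vertices
(`u_i v_i`, `u_i w_i`, `v_i z_i`), all horizontal unit segments in the two middle rows
(`u_i u_{i+1}`, `v_i v_{i+1}`), and, in the top and bottom rows, the horizontal unit segments
`w_i w_{i+1}` and `z_i z_{i+1}` with `i` odd. So the `4n` unit squares of `G_n` are a row of `2n`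
squares together with the squares just above and just below its 2nd, 4th, ..., `2n`-th square. -/
def polyominoGraph (n : ℕ) : SimpleGraph (polyominoVertices n) :=
  SimpleGraph.fromRel fun p q =>
    (p.1.1 = q.1.1 ∧ q.1.2 = p.1.2 + 1) ∨
    (q.1.1 = p.1.1 + 1 ∧ p.1.2 = q.1.2 ∧ (p.1.2 = 1 ∨ p.1.2 = 2 ∨ Odd p.1.1))

open Finset

/-! Cut `G_n` into blocks of columns `2k - 1`, `2k`, block `0` being column `0` alone. An even
number of vertices lies to the left of each cut between blocks, so a perfect matching uses both or
neither of the two middle edges across it. Hence a perfect matching is a word of `n + 1` tiles with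
agreeing cuts (`isPerfectMatching_iff_exists_isWord`).

The forcing number comes from a min-max argument (`forcingNumber_eq_card`): alternating squares with
no matching edge in common bound it from below, and one edge from each bounds it from above provided
that these edges determine the matching. The squares are chosen greedily from left to right: the top
and bottom squares of a block with a splitting tile, the linking square at each used cut, and, in
each maximal run of consecutive vertical middle edges, the square on the first two edges, on the
next two, and so on. `Scan` remembers whether an edge of the run is waiting for a partner.
Disjointness is `IsWord.owner_eq`, determination is `IsWord.eq_of_rep`.

The forcing number is therefore additive along a three-state automaton, and its sum over all words
obeys a linear recursion, solved in `pathSum_succ_eq`. -/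

/-! ### Forcing numbers from packings of alternating sets -/

/-- If `M` has a forcing set of size at most `#Q` and perfect matchings `N q ≠ M` (`q ∈ Q`) whose
differences from `M` are pairwise disjoint, then the forcing number of `M` is `#Q`. -/
theorem forcingNumber_eq_card {V ι : Type*} {G : SimpleGraph V} {M : G.Subgraph} (Q : Finset ι)
    {S : Finset (Sym2 V)} (hS : IsForcingSet M (S : Set (Sym2 V))) (hcard : #S ≤ #Q)
    (N : ι → G.Subgraph) (hN : ∀ q ∈ Q, (N q).IsPerfectMatching) (hne : ∀ q ∈ Q, N q ≠ M)
    (hdisj : ∀ q ∈ Q, ∀ r ∈ Q, ∀ e ∈ M.edgeSet, e ∉ (N q).edgeSet → e ∉ (N r).edgeSet → q = r) :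
    forcingNumber M = #Q := by
  have lower : ∀ T : Finset (Sym2 V), IsForcingSet M (T : Set (Sym2 V)) → #Q ≤ #T := by
    intro T hT
    have hex : ∀ q ∈ Q, ∃ e ∈ T, e ∉ (N q).edgeSet := by
      intro q hq
      by_contra! h
      exact hne q hq (hT.2 _ (hN q hq) fun e he => h e (by simpa using he))
    choose f hf hf' using hex
    have hinj : Function.Injective fun q : Q => (⟨f q.1 q.2, hf q.1 q.2⟩ : T) := by
      rintro ⟨q, hq⟩ ⟨r, hr⟩ hqr
      have hqr : f q hq = f r hr := congrArg Subtype.val hqr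
      exact Subtype.ext (hdisj q hq r hr (f q hq) (hT.1 (by simpa using hf q hq)) (hf' q hq)
        (hqr ▸ hf' r hr))
    simpa using Fintype.card_le_of_injective _ hinj
  have hmem : #S ∈ {k | ∃ S : Finset (Sym2 V), IsForcingSet M (S : Set (Sym2 V)) ∧ #S = k} :=
    ⟨S, hS, rfl⟩
  refine le_antisymm ((Nat.sInf_le hmem).trans hcard) (le_csInf ⟨_, hmem⟩ ?_)
  rintro k ⟨T, hT, rfl⟩
  exact lower T hT

/-! ### Matchings of the polyomino graph as direction fields -/

/-- A unit step of the plane grid. -/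
inductive GridStep
  | left | right | up | down
  deriving DecidableEq

namespace GridStep

instance : Fintype GridStep := ⟨{left, right, up, down}, fun s => by cases s <;> decide⟩

/-- The opposite step. -/
def rev : GridStep → GridStep
  | left => right
  | right => left
  | up => down
  | down => up

/-- The point reached by a step. -/
def move : GridStep → ℕ × ℕ → ℕ × ℕ
  | left, p => (p.1 - 1, p.2)
  | right, p => (p.1 + 1, p.2)
  | up, p => (p.1, p.2 + 1)
  | down, p => (p.1, p.2 - 1)

/-- Truncated subtraction fixes a point under `left` or `down` when the coordinate is `0`. The
hypothesis excludes exactly these failures of reversibility, and likewise of injectivity in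
`move_injective`. -/
theorem rev_move {s : GridStep} {p : ℕ × ℕ} (h : s.move p ≠ p) : s.rev.move (s.move p) = p := by
  obtain ⟨i, j⟩ := p
  cases s <;> simp [move, rev] at h ⊢ <;> omega

theorem move_injective {s t : GridStep} {p : ℕ × ℕ} (h : s.move p ≠ p)
    (hst : s.move p = t.move p) : s = t := by
  obtain ⟨i, j⟩ := p
  cases s <;> cases t <;> simp [move] at h hst ⊢ <;> omega

end GridStep

open GridStep

theorem polyominoGraph_adj {n : ℕ} {p q : polyominoVertices n} :
    (polyominoGraph n).Adj p q ↔
      (p.1.1 = q.1.1 ∧ q.1.2 = p.1.2 + 1) ∨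
      (q.1.1 = p.1.1 + 1 ∧ p.1.2 = q.1.2 ∧ (p.1.2 = 1 ∨ p.1.2 = 2 ∨ Odd p.1.1)) ∨
      (q.1.1 = p.1.1 ∧ p.1.2 = q.1.2 + 1) ∨
      (p.1.1 = q.1.1 + 1 ∧ q.1.2 = p.1.2 ∧ (q.1.2 = 1 ∨ q.1.2 = 2 ∨ Odd q.1.1)) := by
  obtain ⟨⟨i, j⟩, hp⟩ := p
  obtain ⟨⟨k, l⟩, hq⟩ := q
  simp only [polyominoGraph, SimpleGraph.fromRel_adj, ne_eq, Subtype.mk.injEq, Prod.mk.injEq]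
  constructor
  · rintro ⟨-, h⟩
    tauto
  · intro h
    refine ⟨by omega, by tauto⟩

/-- The direction field `d` pairs up the vertices of `G_n` along edges. -/
def IsMating (n : ℕ) (d : ℕ × ℕ → GridStep) : Prop :=
  ∀ p, ∀ hp : p ∈ polyominoVertices n, ∃ hq : (d p).move p ∈ polyominoVertices n,
    (polyominoGraph n).Adj ⟨p, hp⟩ ⟨_, hq⟩ ∧ d ((d p).move p) = (d p).rev

/-- The subgraph that joins every vertex to the one its direction points at. -/
def matchingOf (n : ℕ) (d : ℕ × ℕ → GridStep) : (polyominoGraph n).Subgraph where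
  verts := Set.univ
  Adj p q := (polyominoGraph n).Adj p q ∧ q.1 = (d p.1).move p.1 ∧ p.1 = (d q.1).move q.1
  adj_sub h := h.1
  edge_vert _ := Set.mem_univ _
  symm := ⟨fun _ _ h => ⟨h.1.symm, h.2.2, h.2.1⟩⟩

namespace IsMating

variable {n : ℕ} {d : ℕ × ℕ → GridStep}

theorem move_ne (hd : IsMating n d) {p : ℕ × ℕ} (hp : p ∈ polyominoVertices n) :
    (d p).move p ≠ p := by
  obtain ⟨hq, hadj, -⟩ := hd p hp
  intro h
  exact hadj.ne (Subtype.ext h.symm)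

theorem adj_iff (hd : IsMating n d) {p q : polyominoVertices n} :
    (matchingOf n d).Adj p q ↔ q.1 = (d p.1).move p.1 := by
  refine ⟨fun h => h.2.1, fun h => ?_⟩
  obtain ⟨hq, hadj, hrev⟩ := hd p.1 p.2
  have : q = ⟨_, hq⟩ := Subtype.ext h
  subst this
  exact ⟨hadj, rfl, by rw [hrev, rev_move (hd.move_ne p.2)]⟩

theorem isPerfectMatching (hd : IsMating n d) : (matchingOf n d).IsPerfectMatching := by
  rw [SimpleGraph.Subgraph.isPerfectMatching_iff]
  intro p
  obtain ⟨hq, -, -⟩ := hd p.1 p.2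
  exact ⟨⟨_, hq⟩, hd.adj_iff.2 rfl, fun r hr => Subtype.ext (hd.adj_iff.1 hr)⟩

theorem mem_edgeSet (hd : IsMating n d) {p : ℕ × ℕ} (hp : p ∈ polyominoVertices n)
    (hq : (d p).move p ∈ polyominoVertices n) :
    s((⟨p, hp⟩ : polyominoVertices n), ⟨_, hq⟩) ∈ (matchingOf n d).edgeSet := by
  rw [SimpleGraph.Subgraph.mem_edgeSet, hd.adj_iff]

end IsMating

theorem SimpleGraph.Subgraph.IsPerfectMatching.exists_isMating {n : ℕ}
    {M : (polyominoGraph n).Subgraph} (hM : M.IsPerfectMatching) :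
    ∃ d, IsMating n d ∧ M = matchingOf n d := by
  rw [SimpleGraph.Subgraph.isPerfectMatching_iff] at hM
  have hex : ∀ p, ∃ s : GridStep, ∀ hp : p ∈ polyominoVertices n,
      ∃ hq : s.move p ∈ polyominoVertices n, M.Adj ⟨p, hp⟩ ⟨_, hq⟩ := by
    intro p
    by_cases hp : p ∈ polyominoVertices n
    · obtain ⟨q, hq, -⟩ := hM ⟨p, hp⟩
      have : ∃ s : GridStep, s.move p = q.1 := by
        obtain ⟨⟨k, l⟩, hkl⟩ := q
        obtain ⟨i, j⟩ := p
        rcases polyominoGraph_adj.1 hq.adj_sub with h | h | h | h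
        · exact ⟨up, by simp_all [move]⟩
        · exact ⟨right, by simp_all [move]⟩
        · exact ⟨down, by simp_all [move]⟩
        · exact ⟨left, by simp_all [move]⟩
      obtain ⟨s, hs⟩ := this
      exact ⟨s, fun _ => ⟨hs ▸ q.2, by simpa only [hs] using hq⟩⟩
    · exact ⟨up, fun h => absurd h hp⟩
  choose d hd using hex
  have hmate : IsMating n d := by
    intro p hp
    obtain ⟨hq, hadj⟩ := hd p hp
    refine ⟨hq, hadj.adj_sub, ?_⟩
    obtain ⟨hr, hadj'⟩ := hd _ hq
    have h : (d ((d p).move p)).move ((d p).move p) = p :=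
      congrArg Subtype.val ((hM ⟨_, hq⟩).unique hadj' hadj.symm)
    have hne : (d p).move p ≠ p := fun h => hadj.adj_sub.ne (Subtype.ext h.symm)
    refine move_injective (p := (d p).move p) ?_ ?_
    · rw [h]; exact hne.symm
    · rw [h, rev_move hne]
  refine ⟨d, hmate, ?_⟩
  ext p q
  · simpa [matchingOf] using SimpleGraph.Subgraph.edge_vert _ (hM p).choose_spec.1
  · rw [hmate.adj_iff]
    obtain ⟨hq, hadj⟩ := hd p.1 p.2
    exact ⟨fun h => congrArg Subtype.val ((hM p).unique h hadj), fun h => by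
      rwa [show q = ⟨_, hq⟩ from Subtype.ext h]⟩

/-- Two matings differ at both ends of an edge that belongs only to the first matching. -/
theorem IsMating.ne_of_notMem_edgeSet {n : ℕ} {d d' : ℕ × ℕ → GridStep} (hd : IsMating n d)
    (hd' : IsMating n d') {p q : polyominoVertices n} (h : s(p, q) ∈ (matchingOf n d).edgeSet)
    (h' : s(p, q) ∉ (matchingOf n d').edgeSet) : d p.1 ≠ d' p.1 := by
  rw [SimpleGraph.Subgraph.mem_edgeSet, IsMating.adj_iff ‹_›] at h h'
  exact fun he => h' (he ▸ h)

/-! ### Words of block tilings -/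

/-- The ways in which a perfect matching can cover a block, that is, the columns `2k - 1` and `2k`.
The first five stay within the block, and `flat` consists of four horizontal edges, while `vertTop`,
`vertMid`, `vertBot` and `vertBoth` replace parallel pairs by vertical edges. The last three use the
horizontal edges of the middle rows towards the neighbouring blocks. -/
inductive Tile
  | flat | vertTop | vertMid | vertBot | vertBoth | linkLeft | linkRight | linkBoth
  deriving DecidableEq

namespace Tile

instance : Fintype Tile :=
  ⟨{flat, vertTop, vertMid, vertBot, vertBoth, linkLeft, linkRight, linkBoth},
    fun x => by cases x <;> decide⟩

/-- The tile uses the edges towards the block on the left. -/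
def leftCut : Tile → Bool
  | linkLeft | linkBoth => true
  | _ => false

/-- The tile uses the edges towards the block on the right. -/
def rightCut : Tile → Bool
  | linkRight | linkBoth => true
  | _ => false

/-- The tiles for which the top square and the bottom square are alternating. -/
def splits : Tile → Bool
  | flat | vertTop | vertBot | vertBoth => true
  | _ => false

/-- The step within the block from its right (`r = true`) or left column. -/
def inward (r : Bool) : GridStep := if r then left else right

/-- The step out of the block from its right (`r = true`) or left column. -/
def outward (r : Bool) : GridStep := if r then right else left

/-- The direction of the vertex in the given row of the right (`r = true`) or left column. -/
def dir : Tile → Bool → ℕ → GridStep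
  | vertTop, _, 3 | vertBoth, _, 3 => down
  | vertTop, _, 2 | vertBoth, _, 2 => up
  | vertBot, _, 1 | vertBoth, _, 1 => down
  | vertBot, _, 0 | vertBoth, _, 0 => up
  | vertMid, _, 2 => down
  | vertMid, _, 1 => up
  | linkLeft, true, 2 | linkRight, false, 2 => down
  | linkLeft, true, 1 | linkRight, false, 1 => up
  | linkLeft, false, 2 | linkLeft, false, 1 => left
  | linkRight, true, 2 | linkRight, true, 1 => right
  | linkBoth, r, 2 | linkBoth, r, 1 => outward r
  | _, r, _ => inward r

/-- Rotate the top square of the block, or the middle one for `vertMid`. -/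
def flipTop : Tile → Tile
  | flat => vertTop
  | vertTop => flat
  | vertBot => vertBoth
  | vertBoth => vertBot
  | vertMid => flat
  | x => x

/-- Rotate the bottom square of the block. -/
def flipBot : Tile → Tile
  | flat => vertBot
  | vertBot => flat
  | vertTop => vertBoth
  | vertBoth => vertTop
  | x => x

/-- The effect on the block of rotating the linking square on its right. -/
def flipRight : Tile → Tile
  | linkRight => vertMid
  | vertMid => linkRight
  | linkBoth => linkLeft
  | linkLeft => linkBoth
  | x => x

/-- The effect on the block of rotating the linking square on its left. -/
def flipLeft : Tile → Tile
  | linkLeft => vertMid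
  | vertMid => linkLeft
  | linkBoth => linkRight
  | linkRight => linkBoth
  | x => x

end Tile

open Tile

/-- The situation after a block: its last column has a vertical edge in the middle that is not yet
paired with another one, or no such edge, or the horizontal edges leaving the block are used. -/
inductive Scan
  | free | paired | crossed
  deriving DecidableEq

namespace Scan

instance : Fintype Scan := ⟨{free, paired, crossed}, fun s => by cases s <;> decide⟩

/-- The horizontal edges leaving the block are used. -/
def isCrossed : Scan → Bool
  | crossed => true
  | _ => false

/-- The situation after one more block. -/
def next : Scan → Tile → Scan
  | paired, vertMid => paired
  | _, vertMid | _, linkLeft => free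
  | _, linkRight | _, linkBoth => crossed
  | _, _ => paired

end Scan

open Scan

/-- The alternating squares counted for a block: its top square (or middle one, for `vertMid`), its
bottom square, the linking square on its right if its horizontal edges are used, and the linking
square on its left if its vertical edges are used. -/
inductive Spot
  | top | bot | out | inn
  deriving DecidableEq

/-- The squares of an edge-disjoint family of alternating squares that belong to a block. -/
def spots : Scan → Tile → Finset Spot
  | paired, .vertMid => {.top}
  | .free, .vertMid => {.inn}
  | .free, .linkRight => {.inn, .out}
  | _, .linkRight => {.out}
  | _, .linkBoth => {.out}
  | _, .vertMid => ∅
  | _, .linkLeft => ∅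
  | _, _ => {.top, .bot}

/-- The situation before block `k`. A virtual crossing precedes block `0`. -/
def scan (w : ℕ → Tile) : ℕ → Scan
  | 0 => crossed
  | k + 1 => (scan w k).next (w k)

/-- Whether the horizontal edges before block `k` are used. -/
def cutBefore (w : ℕ → Tile) : ℕ → Bool
  | 0 => true
  | k + 1 => (w k).rightCut

/-- The last tile alone decides whether the state is crossed, so the scan state already knows which
tiles may follow. -/
theorem isCrossed_scan (w : ℕ → Tile) (k : ℕ) : (scan w k).isCrossed = cutBefore w k := by
  have h : ∀ s x, (Scan.next s x).isCrossed = x.rightCut := by decide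
  cases k with
  | zero => rfl
  | succ k => exact h _ _

/-- The first `m` letters of `w` fit together, and the others are trivial. -/
def IsPath (m : ℕ) (w : ℕ → Tile) : Prop :=
  (∀ k < m, (w k).leftCut = cutBefore w k) ∧ ∀ k, m ≤ k → w k = flat

/-- `w` describes a perfect matching with blocks `0, …, n`. -/
def IsWord (n : ℕ) (w : ℕ → Tile) : Prop :=
  IsPath (n + 1) w ∧ cutBefore w (n + 1) = false

/-- The direction field described by a word. -/
def wordDir (w : ℕ → Tile) (p : ℕ × ℕ) : GridStep :=
  (w ((p.1 + 1) / 2)).dir (p.1 % 2 == 0) p.2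

theorem wordDir_right (w : ℕ → Tile) (k j : ℕ) : wordDir w (2 * k, j) = (w k).dir true j := by
  have h : (2 * k + 1) / 2 = k := by omega
  simp [wordDir, h]

theorem wordDir_left (w : ℕ → Tile) (k j : ℕ) :
    wordDir w (2 * k + 1, j) = (w (k + 1)).dir false j := by
  have h : (2 * k + 1 + 1) / 2 = k + 1 := by omega
  have h' : (2 * k + 1) % 2 = 1 := by omega
  simp [wordDir, h, h']

namespace Tile

theorem dir_horizontal : ∀ (x : Tile), ∀ j < 4,
    (x.dir false j = right ↔ x.dir true j = left) := by decide

theorem dir_vertical : ∀ (x : Tile) (r : Bool), ∀ j < 3,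
    (x.dir r j = up ↔ x.dir r (j + 1) = down) := by decide

theorem dir_left : ∀ (x : Tile), ∀ j < 4,
    (x.dir false j = left ↔ x.leftCut = true ∧ (j = 1 ∨ j = 2)) := by decide

theorem dir_right : ∀ (x : Tile), ∀ j < 4,
    (x.dir true j = right ↔ x.rightCut = true ∧ (j = 1 ∨ j = 2)) := by decide

theorem dir_border : ∀ (x : Tile) (r : Bool), x.dir r 0 ≠ down ∧ x.dir r 3 ≠ up := by decide

/-- Leaves six left columns for `exists_dir`, which keeps its case analysis small. -/
theorem left_column_cases :
    ∀ a3 : GridStep, a3 ≠ up → a3 ≠ left → ∀ a2, (a2 = up ↔ a3 = down) →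
    ∀ a1, (a1 = up ↔ a2 = down) → (a1 = left ↔ a2 = left) →
    ∀ a0, (a0 = up ↔ a1 = down) → a0 ≠ down → a0 ≠ left →
    (a3, a2, a1, a0) ∈ [(right, right, right, right), (down, up, right, right),
      (right, down, up, right), (right, right, down, up), (down, up, down, up),
      (right, left, left, right)] := by
  decide

/-- A consistent choice of directions on a block, entered by both or none of the edges on the left,
comes from a tile. -/
theorem exists_dir (a3 a2 a1 a0 b3 b2 b1 b0 : GridStep)
    (h3 : a3 ≠ up) (h3' : a3 ≠ left) (h23 : a2 = up ↔ a3 = down) (h12 : a1 = up ↔ a2 = down)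
    (hcut : a1 = left ↔ a2 = left) (h01 : a0 = up ↔ a1 = down) (h0 : a0 ≠ down) (h0' : a0 ≠ left)
    (k3 : b3 ≠ up) (k3' : b3 ≠ right) (k23 : b2 = up ↔ b3 = down) (k12 : b1 = up ↔ b2 = down)
    (k01 : b0 = up ↔ b1 = down) (k0 : b0 ≠ down) (k0' : b0 ≠ right)
    (m3 : a3 = right ↔ b3 = left) (m2 : a2 = right ↔ b2 = left)
    (m1 : a1 = right ↔ b1 = left) (m0 : a0 = right ↔ b0 = left) :
    ∃ x : Tile,
      (x.dir false 3 = a3 ∧ x.dir false 2 = a2 ∧ x.dir false 1 = a1 ∧ x.dir false 0 = a0) ∧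
      (x.dir true 3 = b3 ∧ x.dir true 2 = b2 ∧ x.dir true 1 = b1 ∧ x.dir true 0 = b0) := by
  have h := left_column_cases a3 h3 h3' a2 h23 a1 h12 hcut a0 h01 h0 h0'
  clear h3 h3' h23 h12 hcut h01 h0 h0'
  simp only [List.mem_cons, Prod.mk.injEq, List.not_mem_nil, or_false] at h
  obtain ⟨rfl, rfl, rfl, rfl⟩ | ⟨rfl, rfl, rfl, rfl⟩ | ⟨rfl, rfl, rfl, rfl⟩ | ⟨rfl, rfl, rfl, rfl⟩ |
    ⟨rfl, rfl, rfl, rfl⟩ | ⟨rfl, rfl, rfl, rfl⟩ := h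
  all_goals
    cases b3 <;> simp at k3 k3' m3
    all_goals cases b0 <;> simp at k0 k0' m0
    all_goals cases b2 <;> simp at k23 m2
    all_goals cases b1 <;> simp at k12 k01 m1
    all_goals decide

end Tile

/-! ### Words and perfect matchings -/

namespace IsWord

variable {n : ℕ} {w : ℕ → Tile}

theorem leftCut_zero (hw : IsWord n w) : (w 0).leftCut = true := hw.1.1 0 (by omega)

theorem leftCut_succ (hw : IsWord n w) {k : ℕ} (hk : k < n) :
    (w (k + 1)).leftCut = (w k).rightCut := hw.1.1 (k + 1) (by omega)

theorem lt_of_rightCut (hw : IsWord n w) {k : ℕ} (hk : k ≤ n) (h : (w k).rightCut = true) :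
    k < n := by
  refine lt_of_le_of_ne hk ?_
  rintro rfl
  exact Bool.false_ne_true (hw.2.symm.trans h)

end IsWord

theorem isWord_iff {n : ℕ} {w : ℕ → Tile} :
    IsWord n w ↔ (w 0).leftCut = true ∧ (∀ k < n, (w (k + 1)).leftCut = (w k).rightCut) ∧
      (w n).rightCut = false ∧ ∀ k, n < k → w k = flat := by
  refine ⟨fun hw => ⟨hw.leftCut_zero, fun k hk => hw.leftCut_succ hk, hw.2,
    fun k hk => hw.1.2 k hk⟩, fun ⟨h0, h, hn, hout⟩ => ⟨⟨?_, fun k hk => hout k hk⟩, hn⟩⟩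
  rintro (_ | k) hk
  · exact h0
  · exact h k (by omega)

theorem mem_polyominoVertices {n i j : ℕ} :
    (i, j) ∈ polyominoVertices n ↔ 1 ≤ n ∧ i ≤ 2 * n ∧ j ≤ 3 ∧ (i = 0 → j = 1 ∨ j = 2) := Iff.rfl

/-- Being a mating is local: `dir_vertical` and `dir_horizontal` treat edges inside a block, and
equality of neighbouring cuts treats the edges between blocks. -/
theorem IsWord.isMating {n : ℕ} {w : ℕ → Tile} (hw : IsWord n w) : IsMating n (wordDir w) := by
  rintro ⟨i, j⟩ hp
  have hp' := mem_polyominoVertices.1 hp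
  obtain ⟨hn, hi, hj, hij⟩ := hp'
  suffices ∃ k l, (wordDir w (i, j)).move (i, j) = (k, l) ∧ (k, l) ∈ polyominoVertices n ∧
      ((i = k ∧ l = j + 1) ∨ (k = i + 1 ∧ j = l ∧ (j = 1 ∨ j = 2 ∨ Odd i)) ∨
      (k = i ∧ j = l + 1) ∨ (i = k + 1 ∧ l = j ∧ (l = 1 ∨ l = 2 ∨ Odd k))) ∧
      wordDir w (k, l) = (wordDir w (i, j)).rev by
    obtain ⟨k, l, h1, h2, h3, h4⟩ := this
    rw [h1]
    exact ⟨h2, polyominoGraph_adj.2 h3, h4⟩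
  -- Block `0` really has only the two middle vertices of its right column; a tile with a left cut
  -- never points from them to a missing vertex.
  have hlink0 : ∀ x : Tile, x.leftCut = true → ∀ j, (j = 1 ∨ j = 2) →
      x.dir true j ≠ left := by
    rintro x hx j (rfl | rfl) <;> revert x <;> decide
  have hvert0 : ∀ x : Tile, x.leftCut = true →
      x.dir true 2 ≠ up ∧ x.dir true 1 ≠ down := by decide
  obtain ⟨k, rfl | rfl⟩ : ∃ k, i = 2 * k ∨ i = 2 * k + 1 := ⟨i / 2, by omega⟩
  · rw [wordDir_right]
    rcases hs : (w k).dir true j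
    · obtain _ | k := k
      · exact absurd hs (hlink0 _ hw.leftCut_zero _ (hij rfl))
      refine ⟨2 * k + 1, j, rfl, ⟨hn, by omega, hj, by omega⟩, ?_, ?_⟩
      · exact Or.inr <| Or.inr <| Or.inr ⟨by ring, rfl, Or.inr <| Or.inr ⟨k, rfl⟩⟩
      · rw [wordDir_left]
        exact (dir_horizontal _ j (by omega)).2 hs
    · obtain ⟨hc, hj'⟩ := (dir_right _ j (by omega)).1 hs
      have hk := hw.lt_of_rightCut (by omega) hc
      refine ⟨2 * k + 1, j, rfl, ⟨hn, by omega, hj, by omega⟩, by omega, ?_⟩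
      rw [wordDir_left]
      exact (dir_left _ j (by omega)).2 ⟨hw.leftCut_succ hk ▸ hc, hj'⟩
    · have hj3 : j ≠ 3 := by rintro rfl; exact (dir_border _ _).2 hs
      refine ⟨2 * k, j + 1, rfl, ⟨hn, by omega, by omega, ?_⟩, by omega, ?_⟩
      · intro h
        obtain rfl : k = 0 := by omega
        rcases hij rfl with rfl | rfl
        · simp
        · exact absurd hs (hvert0 _ hw.leftCut_zero).1
      · rw [wordDir_right]
        exact (dir_vertical _ _ j (by omega)).1 hs
    · obtain _ | j := j
      · exact absurd hs (dir_border _ _).1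
      refine ⟨2 * k, j, rfl, ⟨hn, by omega, by omega, ?_⟩, by omega, ?_⟩
      · intro h
        obtain rfl : k = 0 := by omega
        have hj1 : j + 1 ≠ 1 := fun h1 => (hvert0 _ hw.leftCut_zero).2 (h1 ▸ hs)
        have := hij rfl
        omega
      · rw [wordDir_right]
        exact (dir_vertical _ _ j (by omega)).2 hs
  · have hk : k + 1 ≤ n := by omega
    rw [wordDir_left]
    rcases hs : (w (k + 1)).dir false j
    · obtain ⟨hc, hj'⟩ := (dir_left _ j (by omega)).1 hs
      refine ⟨2 * k, j, rfl, ⟨hn, by omega, hj, fun _ => hj'⟩, by omega, ?_⟩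
      rw [wordDir_right]
      exact (dir_right _ j (by omega)).2 ⟨hw.leftCut_succ hk ▸ hc, hj'⟩
    · refine ⟨2 * (k + 1), j, by simp [move]; ring, ⟨hn, by omega, hj, by omega⟩, ?_, ?_⟩
      · exact Or.inr <| Or.inl ⟨by ring, rfl, Or.inr <| Or.inr ⟨k, rfl⟩⟩
      · rw [wordDir_right]
        exact (dir_horizontal _ j (by omega)).1 hs
    · have hj3 : j ≠ 3 := by rintro rfl; exact (dir_border _ _).2 hs
      refine ⟨2 * k + 1, j + 1, rfl, ⟨hn, by omega, by omega, by omega⟩, by omega, ?_⟩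
      rw [wordDir_left]
      exact (dir_vertical _ _ j (by omega)).1 hs
    · obtain _ | j := j
      · exact absurd hs (dir_border _ _).1
      refine ⟨2 * k + 1, j, rfl, ⟨hn, by omega, by omega, by omega⟩, by omega, ?_⟩
      rw [wordDir_left]
      exact (dir_vertical _ _ j (by omega)).2 hs

/-! ### Reading a word off a mating -/

namespace IsMating

variable {n : ℕ} {d : ℕ × ℕ → GridStep}

theorem horizontal (hd : IsMating n d) {i j : ℕ} (h : (i, j) ∈ polyominoVertices n)
    (h' : (i + 1, j) ∈ polyominoVertices n) : d (i, j) = right ↔ d (i + 1, j) = left := by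
  constructor <;> intro hs
  · simpa [hs, move, rev] using (hd _ h).2.2
  · simpa [hs, move, rev] using (hd _ h').2.2

theorem vertical (hd : IsMating n d) {i j : ℕ} (h : (i, j) ∈ polyominoVertices n)
    (h' : (i, j + 1) ∈ polyominoVertices n) : d (i, j) = up ↔ d (i, j + 1) = down := by
  constructor <;> intro hs
  · simpa [hs, move, rev] using (hd _ h).2.2
  · simpa [hs, move, rev] using (hd _ h').2.2

theorem ne_up (hd : IsMating n d) {i : ℕ} (h : (i, 3) ∈ polyominoVertices n) :
    d (i, 3) ≠ up := by
  intro hs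
  obtain ⟨hq, -, -⟩ := hd _ h
  simp [hs, move, mem_polyominoVertices] at hq

theorem ne_down (hd : IsMating n d) {i : ℕ} (h : (i, 0) ∈ polyominoVertices n) :
    d (i, 0) ≠ down := fun hs => hd.move_ne h (by simp [hs, move])

theorem ne_right (hd : IsMating n d) {k j : ℕ} (h : (2 * k, j) ∈ polyominoVertices n)
    (hj : j = 0 ∨ j = 3) : d (2 * k, j) ≠ right := by
  intro hs
  obtain ⟨hq, hadj, -⟩ := hd _ h
  rw [polyominoGraph_adj] at hadj
  simp only [hs, move, Nat.odd_iff] at hadj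
  omega

theorem ne_left (hd : IsMating n d) {k j : ℕ} (h : (2 * k + 1, j) ∈ polyominoVertices n)
    (hj : j = 0 ∨ j = 3) : d (2 * k + 1, j) ≠ left := by
  intro hs
  obtain ⟨hq, hadj, -⟩ := hd _ h
  rw [polyominoGraph_adj] at hadj
  simp only [hs, move, Nat.odd_iff] at hadj
  omega

theorem ne_right_last (hd : IsMating n d) {j : ℕ} (h : (2 * n, j) ∈ polyominoVertices n) :
    d (2 * n, j) ≠ right := by
  intro hs
  obtain ⟨hq, -, -⟩ := hd _ h
  simp [hs, move, mem_polyominoVertices] at hq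

/-- Column `0` is either matched vertically or sends both vertices to the right: the right halves of
`linkLeft` and `linkBoth`, whose left halves are virtual. -/
theorem exists_tile_zero (hd : IsMating n d) (hn : 1 ≤ n) :
    ∃ x : Tile, x.leftCut = true ∧ x.dir true 1 = d (0, 1) ∧ x.dir true 2 = d (0, 2) := by
  have v1 : (0, 1) ∈ polyominoVertices n := ⟨hn, by simp⟩
  have v2 : (0, 2) ∈ polyominoVertices n := ⟨hn, by simp⟩
  have hv := hd.vertical v1 v2
  have hl1 : d (0, 1) ≠ left := fun hs => hd.move_ne v1 (by simp [hs, move])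
  have hl2 : d (0, 2) ≠ left := fun hs => hd.move_ne v2 (by simp [hs, move])
  have hdn : d (0, 1) ≠ down := by
    intro hs
    obtain ⟨hq, -, -⟩ := hd _ v1
    simp [hs, move, mem_polyominoVertices] at hq
  have hup : d (0, 2) ≠ up := by
    intro hs
    obtain ⟨hq, -, -⟩ := hd _ v2
    simp [hs, move, mem_polyominoVertices] at hq
  generalize d (0, 1) = s at *
  generalize d (0, 2) = t at *
  revert s t
  decide

theorem exists_tile_succ (hd : IsMating n d) {k : ℕ} (hk : k < n)
    (hcut : d (2 * k, 1) = right ↔ d (2 * k, 2) = right) :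
    ∃ x : Tile, ∀ j < 4,
      x.dir false j = d (2 * k + 1, j) ∧ x.dir true j = d (2 * (k + 1), j) := by
  have hl : ∀ j < 4, (2 * k + 1, j) ∈ polyominoVertices n := fun j hj =>
    ⟨by omega, by dsimp only; omega, by dsimp only; omega, by simp⟩
  have hr : ∀ j < 4, (2 * (k + 1), j) ∈ polyominoVertices n := fun j hj =>
    ⟨by omega, by dsimp only; omega, by dsimp only; omega, by simp⟩
  have hm : ∀ j, j = 1 ∨ j = 2 → (2 * k, j) ∈ polyominoVertices n := fun j hj =>
    ⟨by omega, by dsimp only; omega, by dsimp only; omega, fun _ => hj⟩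
  obtain ⟨x, hx, hx'⟩ := exists_dir _ _ _ _ _ _ _ _
    (hd.ne_up (hl 3 (by simp))) (hd.ne_left (hl 3 (by simp)) (by simp))
    (hd.vertical (hl 2 (by simp)) (hl 3 (by simp))) (hd.vertical (hl 1 (by simp)) (hl 2 (by simp)))
    (by rw [← hd.horizontal (hm 1 (by simp)) (hl 1 (by simp)), hcut,
      hd.horizontal (hm 2 (by simp)) (hl 2 (by simp))])
    (hd.vertical (hl 0 (by simp)) (hl 1 (by simp)))
    (hd.ne_down (hl 0 (by simp))) (hd.ne_left (hl 0 (by simp)) (by simp))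
    (hd.ne_up (hr 3 (by simp))) (hd.ne_right (hr 3 (by simp)) (by simp))
    (hd.vertical (hr 2 (by simp)) (hr 3 (by simp))) (hd.vertical (hr 1 (by simp)) (hr 2 (by simp)))
    (hd.vertical (hr 0 (by simp)) (hr 1 (by simp)))
    (hd.ne_down (hr 0 (by simp))) (hd.ne_right (hr 0 (by simp)) (by simp))
    (hd.horizontal (hl 3 (by simp)) (hr 3 (by simp)))
    (hd.horizontal (hl 2 (by simp)) (hr 2 (by simp)))
    (hd.horizontal (hl 1 (by simp)) (hr 1 (by simp)))
    (hd.horizontal (hl 0 (by simp)) (hr 0 (by simp)))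
  refine ⟨x, fun j hj => ?_⟩
  interval_cases j <;> tauto

/-- Every mating of `G_n` is described by a word. -/
theorem exists_isWord (hd : IsMating n d) (hn : 1 ≤ n) :
    ∃ w, IsWord n w ∧ ∀ p ∈ polyominoVertices n, wordDir w p = d p := by
  have hdir : ∀ x : Tile, x.dir true 1 = right ↔ x.dir true 2 = right := by decide
  -- Both or neither of the middle edges leave each block. Every tile has this property, and having
  -- it at one cut is what allows the next tile to be extracted.
  have hcut : ∀ k, k ≤ n → (d (2 * k, 1) = right ↔ d (2 * k, 2) = right) := by
    intro k
    induction k with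
    | zero =>
      obtain ⟨x, -, h1, h2⟩ := hd.exists_tile_zero hn
      intro _
      rw [mul_zero, ← h1, ← h2, hdir]
    | succ k ih =>
      intro hk
      obtain ⟨x, hx⟩ := hd.exists_tile_succ hk (ih (by omega))
      rw [← (hx 1 (by simp)).2, ← (hx 2 (by simp)).2, hdir]
  obtain ⟨x, hx⟩ := hd.exists_tile_zero hn
  have hex : ∀ k, ∃ x : Tile, if k < n then ∀ j < 4,
      x.dir false j = d (2 * k + 1, j) ∧ x.dir true j = d (2 * (k + 1), j) else x = flat := by
    intro k
    by_cases hk : k < n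
    · simpa [hk] using hd.exists_tile_succ hk (hcut k hk.le)
    · simp [hk]
  choose y hy using hex
  have hyl : ∀ k < n, ∀ j < 4, (y k).dir false j = d (2 * k + 1, j) := by
    intro k hk j hj
    have := hy k
    rw [if_pos hk] at this
    exact (this j hj).1
  have hyr : ∀ k < n, ∀ j < 4, (y k).dir true j = d (2 * (k + 1), j) := by
    intro k hk j hj
    have := hy k
    rw [if_pos hk] at this
    exact (this j hj).2
  let w : ℕ → Tile := fun k => Nat.casesOn k x y
  have hr : ∀ k ≤ n, (w k).dir true 1 = d (2 * k, 1) ∧ (w k).dir true 2 = d (2 * k, 2) := by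
    rintro (_ | k) hk
    · exact hx.2
    · exact ⟨hyr k hk 1 (by simp), hyr k hk 2 (by simp)⟩
  have hright : ∀ x : Tile, x.rightCut = true ↔ x.dir true 2 = right := by decide
  have hleft : ∀ x : Tile, x.leftCut = true ↔ x.dir false 2 = left := by decide
  refine ⟨w, isWord_iff.2 ⟨hx.1, fun k hk => ?_, ?_, ?_⟩, ?_⟩
  · rw [Bool.eq_iff_iff, hright, hleft, (hr k hk.le).2]
    change (y k).dir _ _ = _ ↔ _
    rw [hyl k hk 2 (by simp)]
    exact (hd.horizontal ⟨hn, by dsimp only; omega, by simp⟩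
      ⟨hn, by dsimp only; omega, by simp⟩).symm
  · rw [Bool.eq_false_iff, ne_eq, hright, (hr n le_rfl).2]
    exact hd.ne_right_last ⟨hn, by simp⟩
  · rintro (_ | k) hk
    · omega
    · have := hy k
      rwa [if_neg (by omega)] at this
  · rintro ⟨i, j⟩ hp
    obtain ⟨-, hi, hj, hij⟩ := mem_polyominoVertices.1 hp
    obtain ⟨k, rfl | rfl⟩ : ∃ k, i = 2 * k ∨ i = 2 * k + 1 := ⟨i / 2, by omega⟩
    · rw [wordDir_right]
      obtain _ | k := k
      · rcases hij rfl with rfl | rfl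
        · exact hx.2.1
        · exact hx.2.2
      · exact hyr k (by omega) j (by omega)
    · rw [wordDir_left]
      exact hyl k (by omega) j (by omega)

end IsMating

theorem matchingOf_congr {n : ℕ} {d d' : ℕ × ℕ → GridStep}
    (h : ∀ p ∈ polyominoVertices n, d p = d' p) : matchingOf n d = matchingOf n d' := by
  ext p q
  · rfl
  · simp only [matchingOf, h p.1 p.2, h q.1 q.2]

theorem isPerfectMatching_iff_exists_isWord {n : ℕ} (hn : 1 ≤ n)
    {M : (polyominoGraph n).Subgraph} :
    M.IsPerfectMatching ↔ ∃ w, IsWord n w ∧ M = matchingOf n (wordDir w) := by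
  constructor
  · intro hM
    obtain ⟨d, hd, rfl⟩ := hM.exists_isMating
    obtain ⟨w, hw, h⟩ := hd.exists_isWord hn
    exact ⟨w, hw, (matchingOf_congr h).symm⟩
  · rintro ⟨w, hw, rfl⟩
    exact hw.isMating.isPerfectMatching

/-! ### The forcing number of the matching described by a word -/

/-- The only square of the chosen family that may contain the vertex in row `j` of the right
(`r = true`) or left column of block `k`, where `x` is the tile of the block and `s` the situation
before it. -/
def ownerSpot (k : ℕ) (s : Scan) (x : Tile) (r : Bool) (j : ℕ) : ℕ × Spot :=
  if x.splits then (k, if 2 ≤ j then .top else .bot)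
  else if s = paired ∧ x = vertMid then (k, .top)
  else if r then (if x.rightCut then (k, .out) else (k + 1, .inn))
  else if x.leftCut then (k - 1, .out) else (k, .inn)

/-- The only square of the chosen family that may contain the given vertex. -/
def owner (w : ℕ → Tile) (p : ℕ × ℕ) : ℕ × Spot :=
  ownerSpot ((p.1 + 1) / 2) (scan w ((p.1 + 1) / 2)) (w ((p.1 + 1) / 2)) (p.1 % 2 == 0) p.2

/-- Rotate the linking square between the blocks `k` and `k + 1`. -/
def flipLink (w : ℕ → Tile) (k : ℕ) : ℕ → Tile :=
  Function.update (Function.update w k (w k).flipRight) (k + 1) (w (k + 1)).flipLeft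

/-- Rotate a square of the chosen family. -/
def rotateSquare (w : ℕ → Tile) : ℕ × Spot → ℕ → Tile
  | (k, .top) => Function.update w k (w k).flipTop
  | (k, .bot) => Function.update w k (w k).flipBot
  | (k, .out) => flipLink w k
  | (k, .inn) => flipLink w (k - 1)

/-- The chosen family of alternating squares. -/
def squares (n : ℕ) (w : ℕ → Tile) : Finset (ℕ × Spot) :=
  (range (n + 1)).biUnion fun k =>
    (spots (scan w k) (w k)).map ⟨Prod.mk k, Prod.mk_right_injective k⟩

theorem mem_squares {n : ℕ} {w : ℕ → Tile} {k : ℕ} {t : Spot} :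
    (k, t) ∈ squares n w ↔ k ≤ n ∧ t ∈ spots (scan w k) (w k) := by
  simp only [squares, mem_biUnion, mem_range, mem_map, Function.Embedding.coeFn_mk, Prod.mk.injEq]
  constructor
  · rintro ⟨k, hk, t, ht, rfl, rfl⟩
    exact ⟨by omega, ht⟩
  · rintro ⟨hk, ht⟩
    exact ⟨k, by omega, t, ht, rfl, rfl⟩

theorem card_squares (n : ℕ) (w : ℕ → Tile) :
    #(squares n w) = ∑ k ∈ range (n + 1), #(spots (scan w k) (w k)) := by
  rw [squares, card_biUnion]
  · simp
  · intro k _ l _ hkl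
    rw [Function.onFun, disjoint_left]
    simp only [mem_map, Function.Embedding.coeFn_mk, not_exists, not_and, forall_exists_index,
      and_imp]
    rintro _ t - rfl u - h
    exact hkl (congrArg Prod.fst h).symm

/-! ### Rotating the chosen squares, and their disjointness -/

theorem isWord_update {n k : ℕ} {w : ℕ → Tile} (hw : IsWord n w) (hk : k ≤ n) {x : Tile}
    (hl : x.leftCut = (w k).leftCut) (hr : x.rightCut = (w k).rightCut) :
    IsWord n (Function.update w k x) := by
  have hl' : ∀ i, (Function.update w k x i).leftCut = (w i).leftCut := by
    intro i
    by_cases h : i = k <;> simp [h, hl]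
  have hr' : ∀ i, (Function.update w k x i).rightCut = (w i).rightCut := by
    intro i
    by_cases h : i = k <;> simp [h, hr]
  obtain ⟨h0, h1, h2, h3⟩ := isWord_iff.1 hw
  refine isWord_iff.2 ⟨by rw [hl', h0], fun i hi => by rw [hl', hr', h1 i hi], by rw [hr', h2],
    fun i hi => ?_⟩
  rw [Function.update_of_ne (by omega), h3 i hi]

/-- The linking square between two blocks can be rotated. -/
def Linked (w : ℕ → Tile) (k : ℕ) : Prop :=
  w k ∈ ({vertMid, linkLeft, linkRight, linkBoth} : Finset Tile) ∧
    w (k + 1) ∈ ({vertMid, linkLeft, linkRight, linkBoth} : Finset Tile)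

/-- Between tiles of these four kinds the rotation negates the two cut bits that must agree and no
others. -/
theorem isWord_flipLink {n k : ℕ} {w : ℕ → Tile} (hw : IsWord n w) (hk : k < n)
    (hlink : Linked w k) : IsWord n (flipLink w k) := by
  have hR : ∀ x ∈ ({vertMid, linkLeft, linkRight, linkBoth} : Finset Tile),
      x.flipRight.leftCut = x.leftCut ∧ x.flipRight.rightCut = !x.rightCut := by decide
  have hL : ∀ x ∈ ({vertMid, linkLeft, linkRight, linkBoth} : Finset Tile),
      x.flipLeft.rightCut = x.rightCut ∧ x.flipLeft.leftCut = !x.leftCut := by decide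
  obtain ⟨hlink, hlink'⟩ := hlink
  obtain ⟨h0, h1, h2, h3⟩ := isWord_iff.1 hw
  have hl : ∀ i, i ≠ k + 1 → (flipLink w k i).leftCut = (w i).leftCut := by
    intro i hi
    rw [flipLink, Function.update_of_ne hi, Function.update_apply]
    split_ifs with h
    · rw [(hR _ hlink).1, h]
    · rfl
  have hr : ∀ i, i ≠ k → (flipLink w k i).rightCut = (w i).rightCut := by
    intro i hi
    rw [flipLink, Function.update_apply, Function.update_of_ne hi]
    split_ifs with h
    · rw [(hL _ hlink').1, h]
    · rfl
  have hk1 : flipLink w k (k + 1) = (w (k + 1)).flipLeft := by simp [flipLink]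
  have hk0 : flipLink w k k = (w k).flipRight := by simp [flipLink]
  refine isWord_iff.2 ⟨by rw [hl 0 (by omega), h0], fun i hi => ?_, ?_, fun i hi => ?_⟩
  · by_cases h : i = k
    · subst h
      rw [hk1, hk0, (hL _ hlink').2, (hR _ hlink).2, h1 i hi]
    · rw [hl _ (by omega), hr _ h, h1 i hi]
  · rw [hr _ (by omega), h2]
  · rw [flipLink, Function.update_of_ne (by omega), Function.update_of_ne (by omega), h3 i hi]

/-- A waiting vertical edge lies in the block just before. The virtual crossing makes `k` positive,
so `k - 1` in `rotateSquare` is a genuine predecessor for every `inn` square. -/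
theorem scan_eq_free {w : ℕ → Tile} {k : ℕ} (h : scan w k = .free) :
    ∃ l, k = l + 1 ∧ (w l = linkLeft ∨ w l = vertMid ∧ scan w l ≠ paired) := by
  have h' : ∀ s x, Scan.next s x = .free → x = linkLeft ∨ x = vertMid ∧ s ≠ paired := by decide
  obtain _ | l := k
  · cases h
  · exact ⟨l, rfl, h' _ _ h⟩

theorem inn_mem_spots {s : Scan} {x : Tile} (h : .inn ∈ spots s x) :
    s = .free ∧ (x = vertMid ∨ x = linkRight) := by
  revert s x
  decide

theorem out_mem_spots {s : Scan} {x : Tile} (h : .out ∈ spots s x) :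
    x = linkRight ∨ x = linkBoth := by
  revert s x
  decide

theorem top_mem_spots {s : Scan} {x : Tile} (h : .top ∈ spots s x) :
    x.splits = true ∨ s = paired ∧ x = vertMid := by
  revert s x
  decide

theorem bot_mem_spots {s : Scan} {x : Tile} (h : .bot ∈ spots s x) : x.splits = true := by
  revert s x
  decide

theorem leftCut_cases {x : Tile} (h : x.leftCut = true) : x = linkLeft ∨ x = linkBoth := by
  revert x
  decide

theorem IsWord.eq_of_out_mem {n k : ℕ} {w : ℕ → Tile} (hw : IsWord n w) (hk : k ≤ n)
    (h : .out ∈ spots (scan w k) (w k)) :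
    k < n ∧ (w k = linkRight ∨ w k = linkBoth) ∧ (w (k + 1) = linkLeft ∨ w (k + 1) = linkBoth) := by
  have hx := out_mem_spots h
  have hc : (w k).rightCut = true := by rcases hx with hx | hx <;> rw [hx] <;> rfl
  have hk' := hw.lt_of_rightCut hk hc
  exact ⟨hk', hx, leftCut_cases ((hw.leftCut_succ hk').trans hc)⟩

theorem IsWord.isWord_rotateSquare {n : ℕ} {w : ℕ → Tile} (hw : IsWord n w) {q : ℕ × Spot}
    (hq : q ∈ squares n w) : IsWord n (rotateSquare w q) := by
  obtain ⟨k, t⟩ := q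
  obtain ⟨hk, ht⟩ := mem_squares.1 hq
  cases t with
  | top =>
    have h : ∀ x : Tile, x.flipTop.leftCut = x.leftCut ∧ x.flipTop.rightCut = x.rightCut := by
      decide
    exact isWord_update hw hk (h _).1 (h _).2
  | bot =>
    have h : ∀ x : Tile, x.flipBot.leftCut = x.leftCut ∧ x.flipBot.rightCut = x.rightCut := by
      decide
    exact isWord_update hw hk (h _).1 (h _).2
  | out =>
    obtain ⟨hk', h1, h2⟩ := hw.eq_of_out_mem hk ht
    refine isWord_flipLink hw hk' ⟨?_, ?_⟩
    · rcases h1 with h | h <;> simp [h]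
    · rcases h2 with h | h <;> simp [h]
  | inn =>
    obtain ⟨hs, hx⟩ := inn_mem_spots ht
    obtain ⟨l, rfl, hl⟩ := scan_eq_free hs
    refine isWord_flipLink hw (by omega) ⟨?_, ?_⟩
    · rcases hl with h | ⟨h, -⟩ <;> simp [h]
    · rcases hx with h | h <;> simp [h]

theorem wordDir_update {w : ℕ → Tile} {k : ℕ} {x : Tile} {p : ℕ × ℕ}
    (h : wordDir w p ≠ wordDir (Function.update w k x) p) :
    (p.1 + 1) / 2 = k ∧ (w k).dir (p.1 % 2 == 0) p.2 ≠ x.dir (p.1 % 2 == 0) p.2 := by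
  by_cases hk : (p.1 + 1) / 2 = k
  · subst hk
    simpa [wordDir] using h
  · simp [wordDir, Function.update_of_ne hk] at h

theorem wordDir_flipLink {w : ℕ → Tile} {k : ℕ} {p : ℕ × ℕ}
    (h : wordDir w p ≠ wordDir (flipLink w k) p) :
    ((p.1 + 1) / 2 = k ∧
      (w k).dir (p.1 % 2 == 0) p.2 ≠ (w k).flipRight.dir (p.1 % 2 == 0) p.2) ∨
    ((p.1 + 1) / 2 = k + 1 ∧
      (w (k + 1)).dir (p.1 % 2 == 0) p.2 ≠ (w (k + 1)).flipLeft.dir (p.1 % 2 == 0) p.2) := by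
  by_cases hk : (p.1 + 1) / 2 = k + 1
  · refine Or.inr ⟨hk, ?_⟩
    simpa [wordDir, flipLink, hk] using h
  · by_cases hk' : (p.1 + 1) / 2 = k
    · refine Or.inl ⟨hk', ?_⟩
      subst hk'
      simpa [wordDir, flipLink] using h
    · simp [wordDir, flipLink, Function.update_of_ne hk, Function.update_of_ne hk'] at h

/-- A vertex whose direction changes under a rotation recovers the rotated square, so no vertex is
affected by two squares of the family. -/
theorem IsWord.owner_eq {n : ℕ} {w : ℕ → Tile} (hw : IsWord n w) {q : ℕ × Spot}
    (hq : q ∈ squares n w) {p : ℕ × ℕ} (hp : p.2 < 4)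
    (hne : wordDir w p ≠ wordDir (rotateSquare w q) p) : owner w p = q := by
  obtain ⟨k, t⟩ := q
  obtain ⟨i, j⟩ := p
  obtain ⟨hk, ht⟩ := mem_squares.1 hq
  have hflipRight : ∀ x : Tile, ∀ r, ∀ j < 4, x.dir r j ≠ x.flipRight.dir r j → r = true := by
    decide
  have hflipLeft : ∀ x : Tile, ∀ r, ∀ j < 4, x.dir r j ≠ x.flipLeft.dir r j → r = false := by
    decide
  cases t with
  | top =>
    obtain ⟨hi, h⟩ := wordDir_update hne
    have hrow : ∀ x : Tile, x.splits → ∀ r, ∀ j < 4, x.dir r j ≠ x.flipTop.dir r j → 2 ≤ j := by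
      decide
    rcases top_mem_spots ht with hx | ⟨hs, hx⟩
    · simp [owner, ownerSpot, hi, hx, hrow _ hx _ _ hp h]
    · simp [owner, ownerSpot, hi, hx, hs, splits]
  | bot =>
    obtain ⟨hi, h⟩ := wordDir_update hne
    have hrow : ∀ x : Tile, x.splits → ∀ r, ∀ j < 4, x.dir r j ≠ x.flipBot.dir r j → ¬ 2 ≤ j := by
      decide
    have hx := bot_mem_spots ht
    have := hrow _ hx _ _ hp h
    simp only [owner, ownerSpot, hi, hx, if_true, if_neg this]
  | out =>
    obtain ⟨hk', h1, h2⟩ := hw.eq_of_out_mem hk ht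
    rcases wordDir_flipLink hne with ⟨hi, h⟩ | ⟨hi, h⟩
    · have hr := hflipRight _ _ _ hp h
      rcases h1 with h1 | h1 <;>
        simp [owner, ownerSpot, hi, h1, splits, rightCut, beq_iff_eq.1 hr]
    · have hr := hflipLeft _ _ _ hp h
      simp only [owner, ownerSpot, hi, hr]
      rcases h2 with h2 | h2 <;>
        simp [h2, splits, leftCut]
  | inn =>
    obtain ⟨hs, hx⟩ := inn_mem_spots ht
    obtain ⟨l, rfl, hl⟩ := scan_eq_free hs
    rcases wordDir_flipLink hne with ⟨hi, h⟩ | ⟨hi, h⟩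
    · have hr := hflipRight _ _ _ hp h
      simp only [add_tsub_cancel_right] at hi
      simp only [owner, ownerSpot, hi, hr]
      rcases hl with hl | ⟨hl, hl'⟩
      · simp [hl, splits, rightCut]
      · simp [hl, hl', splits, rightCut]
    · simp only [add_tsub_cancel_right] at hi h
      have hr := hflipLeft _ _ _ hp h
      simp only [owner, ownerSpot, hi, hr]
      rcases hx with hx | hx <;> simp [hx, hs, splits, leftCut]

/-! ### Representatives form a forcing set -/

/-- A vertex whose edge represents the given square in a minimum forcing set. -/
def rep : ℕ × Spot → ℕ × ℕ
  | (k, .top) => (2 * k, 2)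
  | (k, .bot) => (2 * k - 1, 1)
  | (k, .out) => (2 * k + 1, 2)
  | (k, .inn) => (2 * k - 1, 2)

theorem IsWord.splits_ne_zero {n k : ℕ} {w : ℕ → Tile} (hw : IsWord n w)
    (h : (w k).splits = true) : k ≠ 0 := by
  rintro rfl
  rcases leftCut_cases hw.leftCut_zero with hx | hx <;> rw [hx] at h <;> cases h

theorem IsWord.rep_mem {n : ℕ} (hn : 1 ≤ n) {w : ℕ → Tile} (hw : IsWord n w) {q : ℕ × Spot}
    (hq : q ∈ squares n w) : rep q ∈ polyominoVertices n := by
  obtain ⟨k, t⟩ := q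
  obtain ⟨hk, ht⟩ := mem_squares.1 hq
  cases t with
  | top => exact ⟨hn, by dsimp only [rep]; omega, by simp [rep], by simp [rep]⟩
  | bot => exact ⟨hn, by dsimp only [rep]; omega, by simp [rep], by simp [rep]⟩
  | inn => exact ⟨hn, by dsimp only [rep]; omega, by simp [rep], by simp [rep]⟩
  | out =>
    have := (hw.eq_of_out_mem hk ht).1
    exact ⟨hn, by dsimp only [rep]; omega, by simp [rep], by simp [rep]⟩

/-- A word is determined by its directions at the representing vertices. -/
theorem IsWord.eq_of_rep {n : ℕ} {w v : ℕ → Tile} (hw : IsWord n w) (hv : IsWord n v)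
    (h : ∀ q ∈ squares n w, wordDir v (rep q) = wordDir w (rep q)) : v = w := by
  have htop : ∀ k ≤ n, .top ∈ spots (scan w k) (w k) → (v k).dir true 2 = (w k).dir true 2 := by
    intro k hk ht
    simpa only [rep, wordDir_right] using h _ (mem_squares.2 ⟨hk, ht⟩)
  have hbot : ∀ k < n, .bot ∈ spots (scan w (k + 1)) (w (k + 1)) →
      (v (k + 1)).dir false 1 = (w (k + 1)).dir false 1 := by
    intro k hk ht
    rw [← wordDir_left, ← wordDir_left]
    exact h _ (mem_squares.2 ⟨hk, ht⟩)
  have hinn : ∀ k < n, .inn ∈ spots (scan w (k + 1)) (w (k + 1)) →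
      (v (k + 1)).dir false 2 = (w (k + 1)).dir false 2 := by
    intro k hk ht
    rw [← wordDir_left, ← wordDir_left]
    exact h _ (mem_squares.2 ⟨hk, ht⟩)
  have hout : ∀ k < n, .out ∈ spots (scan w k) (w k) →
      (v (k + 1)).dir false 2 = (w (k + 1)).dir false 2 := by
    intro k hk ht
    rw [← wordDir_left, ← wordDir_left]
    exact h _ (mem_squares.2 ⟨hk.le, ht⟩)
  have hsplit : ∀ k ≤ n, (w k).splits = true → v k = w k := by
    intro k hk hx
    obtain ⟨k, rfl⟩ := Nat.exists_eq_succ_of_ne_zero (hw.splits_ne_zero hx)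
    have hmem : ∀ s (x : Tile), x.splits = true → .top ∈ spots s x ∧ .bot ∈ spots s x := by decide
    have hdet : ∀ x y : Tile, x.splits = true → y.dir true 2 = x.dir true 2 →
        y.dir false 1 = x.dir false 1 → y = x := by decide
    exact hdet _ _ hx (htop _ hk (hmem _ _ hx).1) (hbot _ hk (hmem _ _ hx).2)
  have hleft : ∀ x : Tile, x.leftCut = true ↔ x.dir false 2 = left := by decide
  -- The cut after block `k` is visible at the vertex `(2k + 1, 2)`, which represents both the `out`
  -- square of block `k` and the `inn` square of block `k + 1`.
  have hright : ∀ k ≤ n, (w k).splits = false → ¬ (w k = vertMid ∧ scan w k = paired) →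
      (v k).rightCut = (w k).rightCut := by
    intro k hk hx hx'
    obtain rfl | hk := hk.eq_or_lt
    · exact hv.2.trans hw.2.symm
    rw [← hw.leftCut_succ hk, ← hv.leftCut_succ hk, Bool.eq_iff_iff, hleft, hleft]
    by_cases hy : (w (k + 1)).splits = true
    · rw [hsplit _ hk hy]
    suffices .out ∈ spots (scan w k) (w k) ∨ .inn ∈ spots (scan w (k + 1)) (w (k + 1)) by
      rcases this with h | h
      · rw [hout k hk h]
      · rw [hinn k hk h]
    -- If the cut is used, `out` is present; if not, block `k` ends with a waiting vertical edge and
    -- the next block starts with one, so `inn` is present.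
    have key : ∀ s (x y : Tile), x.splits = false → ¬ (x = vertMid ∧ s = paired) →
        y.leftCut = x.rightCut → ¬ y.splits = true →
        .out ∈ spots s x ∨ .inn ∈ spots (Scan.next s x) y := by decide
    exact key _ _ _ hx hx' (hw.leftCut_succ hk) hy
  suffices ∀ k ≤ n, v k = w k by
    funext k
    by_cases hk : k ≤ n
    · exact this k hk
    · rw [hv.1.2 k (by omega), hw.1.2 k (by omega)]
  intro k
  induction k with
  | zero =>
    intro hk
    have h1 : ∀ x y : Tile, x.leftCut = true → y.leftCut = true → y.rightCut = x.rightCut →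
        y = x := by decide
    have h2 : ∀ x : Tile, x.leftCut = true → x.splits = false ∧ x ≠ vertMid := by decide
    have h3 := h2 _ hw.leftCut_zero
    exact h1 _ _ hw.leftCut_zero hv.leftCut_zero (hright 0 hk h3.1 fun h => h3.2 h.1)
  | succ k ih =>
    intro hk
    have hl : (v (k + 1)).leftCut = (w (k + 1)).leftCut := by
      rw [hw.leftCut_succ hk, hv.leftCut_succ hk, ih (by omega)]
    by_cases hx : (w (k + 1)).splits = true
    · exact hsplit _ hk hx
    by_cases hx' : w (k + 1) = vertMid ∧ scan w (k + 1) = paired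
    -- The representative lies in the right column because the left cut is already known: `down`
    -- there leaves only `vertMid`, while in the left column it would also allow `linkRight`.
    · have ht := htop (k + 1) hk (by rw [hx'.1, hx'.2]; decide)
      rw [hx'.1] at ht hl ⊢
      revert ht hl
      generalize v (k + 1) = y
      revert y
      decide
    -- Both cuts now agree, which fixes the three linking tiles; a `vertMid` is told apart from the
    -- splitting tiles by its `inn` representative.
    · have hr := hright _ hk (by simpa using hx) hx'
      have hi := hinn k hk
      have hc : (scan w (k + 1)).isCrossed = (w (k + 1)).leftCut := by
        rw [isCrossed_scan, hw.leftCut_succ hk]; rfl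
      revert hx hx' hr hi hc hl
      generalize v (k + 1) = y
      generalize w (k + 1) = x
      generalize scan w (k + 1) = s
      revert y x s
      decide

theorem IsWord.matchingOf_injective {n : ℕ} (hn : 1 ≤ n) {v w : ℕ → Tile} (hv : IsWord n v)
    (hw : IsWord n w) (h : matchingOf n (wordDir v) = matchingOf n (wordDir w)) : v = w := by
  refine hw.eq_of_rep hv fun q hq => ?_
  have hp := hw.rep_mem hn hq
  have hadj : (matchingOf n (wordDir v)).Adj ⟨_, hp⟩ ⟨_, (hw.isMating _ hp).1⟩ := by
    rw [h, hw.isMating.adj_iff]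
  exact (move_injective (hw.isMating.move_ne hp) (hv.isMating.adj_iff.1 hadj)).symm

theorem rotateSquare_ne {n : ℕ} {w : ℕ → Tile} {q : ℕ × Spot}
    (hq : q ∈ squares n w) : rotateSquare w q ≠ w := by
  obtain ⟨k, t⟩ := q
  obtain ⟨hk, ht⟩ := mem_squares.1 hq
  intro h
  have h := congrFun h k
  cases t with
  | top =>
    simp only [rotateSquare, Function.update_self] at h
    revert h ht
    generalize scan w k = s
    generalize w k = x
    revert s x
    decide
  | bot =>
    simp only [rotateSquare, Function.update_self] at h
    revert h ht
    generalize scan w k = s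
    generalize w k = x
    revert s x
    decide
  | out =>
    simp only [rotateSquare, flipLink, ne_eq, Nat.left_eq_add, one_ne_zero, not_false_eq_true,
      Function.update_of_ne, Function.update_self] at h
    rcases out_mem_spots ht with hx | hx <;> rw [hx] at h <;> cases h
  | inn =>
    obtain ⟨hs, hx⟩ := inn_mem_spots ht
    obtain ⟨l, rfl, -⟩ := scan_eq_free hs
    simp only [rotateSquare, flipLink, add_tsub_cancel_right, Function.update_self] at h
    rcases hx with hx | hx <;> rw [hx] at h <;> cases h

theorem IsWord.forcingNumber_matchingOf {n : ℕ} (hn : 1 ≤ n) {w : ℕ → Tile} (hw : IsWord n w) :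
    forcingNumber (matchingOf n (wordDir w)) =
      ∑ k ∈ range (n + 1), #(spots (scan w k) (w k)) := by
  classical
  rw [← card_squares]
  have hd := hw.isMating
  let vertex : squares n w → polyominoVertices n := fun q => ⟨rep q.1, hw.rep_mem hn q.2⟩
  let edge : squares n w → Sym2 (polyominoVertices n) := fun q =>
    s(vertex q, ⟨_, (hd _ (vertex q).2).1⟩)
  refine forcingNumber_eq_card (S := univ.image edge) (squares n w) ⟨?_, ?_⟩ ?_
    (fun q => matchingOf n (wordDir (rotateSquare w q))) ?_ ?_ ?_
  · intro e he
    obtain ⟨q, -, rfl⟩ := mem_image.1 (mem_coe.1 he)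
    exact hd.mem_edgeSet _ _
  · intro M' hM' hsub
    obtain ⟨v, hv, rfl⟩ := (isPerfectMatching_iff_exists_isWord hn).1 hM'
    rw [hw.eq_of_rep hv fun q hq => ?_]
    have hmem : edge ⟨q, hq⟩ ∈ (matchingOf n (wordDir v)).edgeSet :=
      hsub (mem_coe.2 (mem_image_of_mem _ (mem_univ _)))
    rw [SimpleGraph.Subgraph.mem_edgeSet, hv.isMating.adj_iff] at hmem
    exact (move_injective (hd.move_ne (hw.rep_mem hn hq)) hmem).symm
  · exact card_image_le.trans (by simp)
  · exact fun q hq => (hw.isWord_rotateSquare hq).isMating.isPerfectMatching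
  · intro q hq h
    exact rotateSquare_ne hq ((hw.isWord_rotateSquare hq).matchingOf_injective hn hw h)
  · intro q hq r hr e he hq' hr'
    induction e with
    | _ p p' =>
      have hp : p.1.2 < 4 := Nat.lt_succ_of_le p.2.2.2.1
      rw [← hw.owner_eq hq hp
          (hd.ne_of_notMem_edgeSet (hw.isWord_rotateSquare hq).isMating he hq'),
        ← hw.owner_eq hr hp
          (hd.ne_of_notMem_edgeSet (hw.isWord_rotateSquare hr).isMating he hr')]

/-! ### Summation over words -/

theorem scan_update (w : ℕ → Tile) (m : ℕ) (x : Tile) {k : ℕ} (hk : k ≤ m) :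
    scan (Function.update w m x) k = scan w k := by
  induction k with
  | zero => rfl
  | succ k ih => rw [scan, scan, ih (by omega), Function.update_of_ne (by omega)]

/-- Padding with `flat` makes truncation an update of one letter, so words of every length live in
`ℕ → Tile`. -/
theorem isPath_succ_iff {m : ℕ} {w : ℕ → Tile} :
    IsPath (m + 1) w ↔ IsPath m (Function.update w m flat) ∧
      (w m).leftCut = (scan w m).isCrossed := by
  have h : ∀ k ≤ m, cutBefore (Function.update w m flat) k = cutBefore w k := fun k hk => by
    rw [← isCrossed_scan, scan_update w m flat hk, isCrossed_scan]
  rw [isCrossed_scan]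
  refine ⟨fun hw => ⟨⟨fun k hk => ?_, fun k hk => ?_⟩, hw.1 m (by omega)⟩,
    fun ⟨hw, hm⟩ => ⟨fun k hk => ?_, fun k hk => ?_⟩⟩
  · rw [h k hk.le, Function.update_of_ne hk.ne, hw.1 k (by omega)]
  · obtain rfl | hk := hk.eq_or_lt
    · simp
    · rw [Function.update_of_ne hk.ne', hw.2 k hk]
  · obtain rfl | hk := (Nat.le_of_lt_succ hk).eq_or_lt
    · exact hm
    · have := hw.1 k hk
      rwa [h k hk.le, Function.update_of_ne hk.ne] at this
  · have := hw.2 k (by omega)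
    rwa [Function.update_of_ne (by omega)] at this

open Classical in
/-- The paths of length `m`. -/
noncomputable def paths : ℕ → Finset (ℕ → Tile)
  | 0 => {fun _ => flat}
  | m + 1 => (paths m).biUnion fun w =>
      ((univ : Finset Tile).filter fun x => x.leftCut = (scan w m).isCrossed).map
        ⟨Function.update w m, Function.update_injective w m⟩

theorem mem_paths {m : ℕ} {w : ℕ → Tile} : w ∈ paths m ↔ IsPath m w := by
  induction m generalizing w with
  | zero => simp [paths, IsPath, funext_iff]
  | succ m ih =>
    simp only [paths, mem_biUnion, mem_map, mem_filter, mem_univ, true_and,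
      Function.Embedding.coeFn_mk, ih, isPath_succ_iff]
    constructor
    · rintro ⟨v, hv, x, hx, rfl⟩
      have : Function.update (Function.update v m x) m flat = v := by
        rw [Function.update_idem, ← hv.2 m le_rfl, Function.update_eq_self]
      rw [this, scan_update _ _ _ le_rfl]
      exact ⟨hv, by simpa using hx⟩
    · rintro ⟨hv, hx⟩
      exact ⟨_, hv, w m, by rwa [scan_update _ _ _ le_rfl], by simp⟩

open Classical in
theorem sum_paths_succ (m : ℕ) (F : (ℕ → Tile) → ℝ) :
    ∑ w ∈ paths (m + 1), F w =
      ∑ w ∈ paths m, ∑ x with x.leftCut = (scan w m).isCrossed, F (Function.update w m x) := by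
  rw [paths, sum_biUnion]
  · simp only [sum_map, Function.Embedding.coeFn_mk]
  · intro v hv w hw hvw
    rw [Function.onFun, disjoint_left]
    simp only [mem_map, mem_filter, mem_univ, true_and, Function.Embedding.coeFn_mk, not_exists,
      not_and, forall_exists_index, and_imp]
    rintro _ x - rfl y - h
    refine hvw ?_
    have h := congrArg (fun u => Function.update u m flat) h
    simp only [Function.update_idem] at h
    rw [← (mem_paths.1 hv).2 m le_rfl, Function.update_eq_self] at h
    rw [← h, (mem_paths.1 hv).2 m le_rfl, ← (mem_paths.1 hw).2 m le_rfl, Function.update_eq_self]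

/-! ### Transfer recursion -/

/-- The number of chosen alternating squares in the first `m` blocks. -/
def cost (m : ℕ) (w : ℕ → Tile) : ℕ := ∑ k ∈ range m, #(spots (scan w k) (w k))

theorem cost_update (w : ℕ → Tile) (m : ℕ) (x : Tile) :
    cost (m + 1) (Function.update w m x) = cost m w + #(spots (scan w m) x) := by
  rw [cost, sum_range_succ, scan_update _ _ _ le_rfl, Function.update_self, cost]
  congr 1
  refine sum_congr rfl fun k hk => ?_
  have hk := mem_range.1 hk
  rw [scan_update _ _ _ hk.le, Function.update_of_ne hk.ne]

/-- The sum over the paths of length `m` of an affine function of the cost whose coefficients depend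
on the final situation. -/
noncomputable def pathSum (m : ℕ) (a b : Scan → ℝ) : ℝ :=
  ∑ w ∈ paths m, (a (scan w m) * cost m w + b (scan w m))

theorem pathSum_zero (a b : Scan → ℝ) : pathSum 0 a b = b crossed := by
  simp [pathSum, paths, cost, scan]

/-- Appending a tile shifts the cost by a constant depending on state and tile, so affine functions
of the cost stay affine and only their coefficients are pulled back along the automaton. -/
theorem pathSum_succ (m : ℕ) (a b : Scan → ℝ) :
    pathSum (m + 1) a b = pathSum m
      (fun s => ∑ x with Tile.leftCut x = s.isCrossed, a (s.next x))
      (fun s => ∑ x with Tile.leftCut x = s.isCrossed,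
        (a (s.next x) * #(spots s x) + b (s.next x))) := by
  rw [pathSum, sum_paths_succ, pathSum]
  refine sum_congr rfl fun w _ => ?_
  rw [sum_mul, ← sum_add_distrib]
  refine sum_congr rfl fun x _ => ?_
  rw [cost_update, scan, scan_update _ _ _ le_rfl, Function.update_self]
  push_cast
  ring

theorem sum_tile (s : Scan) (F : Tile → ℝ) :
    ∑ x with Tile.leftCut x = s.isCrossed, F x =
      if s = crossed then F linkLeft + F linkBoth
      else F flat + F vertTop + F vertMid + F vertBot + F vertBoth + F linkRight := by
  have h : ∀ s : Scan, (univ.filter fun x => Tile.leftCut x = s.isCrossed) =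
      if s = crossed then {linkLeft, linkBoth}
      else {flat, vertTop, vertMid, vertBot, vertBoth, linkRight} := by decide
  rw [h]
  split_ifs
  · simp
  · simp [add_assoc]

/-- Merging `free` and `paired` turns the counting matrix into `[[5, 1], [1, 1]]`, with
characteristic polynomial `λ² - 6λ + 4` and roots `3 ± √5`; the full three-state matrix has trace
`7`, so its third eigenvalue is `1`. Summing costs doubles each eigenvalue, whence the factors `n`.
Arbitrary `a` and `b` are needed because the recursion changes them. -/
theorem pathSum_succ_eq (n : ℕ) (a b : Scan → ℝ) :
    pathSum (n + 1) a b =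
      b .free * (4 + (-3 / 2 - 7 / 10 * √5) * (3 - √5) ^ n + (-3 / 2 + 7 / 10 * √5) * (3 + √5) ^ n)
      + b paired * (-4 + (2 + 2 / 5 * √5) * (3 - √5) ^ n + (2 - 2 / 5 * √5) * (3 + √5) ^ n)
      + b crossed * ((1 / 2 + 1 / 10 * √5) * (3 - √5) ^ n + (1 / 2 - 1 / 10 * √5) * (3 + √5) ^ n)
      + a .free * (-112 + 20 * n
        + (56 + 628 / 25 * √5 + (57 / 10 + 5 / 2 * √5) * n) * (3 - √5) ^ n
        + (56 - 628 / 25 * √5 + (57 / 10 - 5 / 2 * √5) * n) * (3 + √5) ^ n)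
      + a paired * (108 - 20 * n
        + (-54 - 606 / 25 * √5 + (-22 / 5 - 14 / 5 * √5) * n) * (3 - √5) ^ n
        + (-54 + 606 / 25 * √5 + (-22 / 5 + 14 / 5 * √5) * n) * (3 + √5) ^ n)
      + a crossed * (16
        + (-15 / 2 - 163 / 50 * √5 + (-11 / 10 - 7 / 10 * √5) * n) * (3 - √5) ^ n
        + (-15 / 2 + 163 / 50 * √5 + (-11 / 10 + 7 / 10 * √5) * n) * (3 + √5) ^ n) := by
  have h5 : √5 ^ 2 = 5 := Real.sq_sqrt (by norm_num)
  induction n generalizing a b with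
  | zero =>
    rw [pathSum_succ, pathSum_zero, sum_tile]
    simp [spots, Scan.next]
    ring
  | succ n ih =>
    rw [pathSum_succ, ih]
    simp only [sum_tile]
    simp [spots, Scan.next]
    rw [pow_succ, pow_succ]
    generalize (3 - √5) ^ n = X
    generalize (3 + √5) ^ n = Y
    ring_nf
    simp only [h5]
    ring

/-! ### Assembly, with the null graph treated apart -/

theorem degreeOfFreedom_polyominoGraph_zero : degreeOfFreedom (polyominoGraph 0) = 0 := by
  have : IsEmpty (polyominoVertices 0) := ⟨fun p => absurd p.2.1 (by omega)⟩
  rw [degreeOfFreedom_eq_sum]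
  refine sum_eq_zero fun M _ => ?_
  have hmem : 0 ∈ {k | ∃ S : Finset (Sym2 (polyominoVertices 0)),
      IsForcingSet M (S : Set (Sym2 (polyominoVertices 0))) ∧ #S = k} := by
    refine ⟨∅, ⟨by simp, fun M' _ _ => ?_⟩, rfl⟩
    ext p
    · exact isEmptyElim p
    · exact isEmptyElim p
  exact Nat.le_zero.1 (Nat.sInf_le hmem)

/-- The weight discards paths whose last block crosses the right border; the remaining paths are
exactly the words. -/
theorem degreeOfFreedom_polyominoGraph {n : ℕ} (hn : 1 ≤ n) :
    (degreeOfFreedom (polyominoGraph n) : ℝ) =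
      pathSum (n + 1) (fun s => if s = crossed then 0 else 1) 0 := by
  rw [degreeOfFreedom_eq_sum, Nat.cast_sum, pathSum]
  have hcr : ∀ w, scan w (n + 1) = crossed ↔ cutBefore w (n + 1) = true := fun w => by
    rw [← isCrossed_scan]
    generalize scan w (n + 1) = s
    revert s
    decide
  simp only [Pi.zero_apply, add_zero, ite_mul, zero_mul, one_mul, ← ite_not (p := _ = crossed)]
  rw [← sum_filter]
  symm
  have hword : ∀ w, w ∈ (paths (n + 1)).filter (fun w => ¬ scan w (n + 1) = crossed) ↔
      IsWord n w := fun w => by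
    rw [mem_filter, mem_paths, hcr, IsWord, Bool.not_eq_true]
  refine sum_bij (fun w _ => matchingOf n (wordDir w)) ?_ ?_ ?_ ?_
  · intro w hw
    simpa [perfectMatchings] using ((hword w).1 hw).isMating.isPerfectMatching
  · intro v hv w hw h
    exact ((hword v).1 hv).matchingOf_injective hn ((hword w).1 hw) h
  · intro M hM
    obtain ⟨w, hw, rfl⟩ := (isPerfectMatching_iff_exists_isWord hn).1
      (by simpa [perfectMatchings] using hM : M.IsPerfectMatching)
    exact ⟨w, (hword w).2 hw, rfl⟩
  · intro w hw
    rw [((hword w).1 hw).forcingNumber_matchingOf hn, cost]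

theorem theorem3p4 (n : ℕ) :
    (degreeOfFreedom (polyominoGraph n) : ℝ) =
      -4 + (50 + 22 * √5) / 25 * (3 - √5) ^ n + (13 - 3 * √5) / 10 * (n : ℝ) * (3 - √5) ^ n
        + (50 - 22 * √5) / 25 * (3 + √5) ^ n
        + (13 + 3 * √5) / 10 * (n : ℝ) * (3 + √5) ^ n := by
  obtain rfl | hn := Nat.eq_zero_or_pos n
  · rw [degreeOfFreedom_polyominoGraph_zero]
    norm_num
    ring
  -- With equal weights on `free` and `paired`, the terms `20 * n` of the eigenvalue `1` cancel and
  -- `-112 + 108` leaves `-4`.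
  · rw [degreeOfFreedom_polyominoGraph hn, pathSum_succ_eq]
    simp
    ring
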